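/- Let $m\ge n\ge 1$. For a real matrix $X$ write $\|X\|_\infty,\|X\|_2,\|X\|_F$ for the induced $\infty$-norm, the spectral norm and the Frobenius norm, $X^\dagger$ for the Moore--Penrose inverse, $\kappa_2(X)=\|X\|_2\|X^{-1}\|_2$ and $\kappa_\infty(X)=\|X\|_\infty\|X^{-1}\|_\infty$ for invertible $X$, and $\kappa_\infty(A)=\|A\|_\infty\|A^\dagger\|_\infty$ for a rectangular matrix $A$ of full column rank. Let $A\in\mathbb R^{m\times n}$ have full column rank, let $D\in\mathbb R^{m\times m}$ be diagonal with positive diagonal entries, let $\alpha\in\mathbb R$, $Q\in\mathbb R^{m\times n}$, $\widehat R\in\mathbb R^{n\times n}$, and put $$\widetilde A=\begin{bmatrix}\alpha D^{-1}&A\\A^T&0\end{bmatrix},\quad M_l=\begin{bmatrix}\alpha D^{-1}&Q\widehat R\\ \widehat R^TQ^T&0\end{bmatrix},\quad E=Q\widehat R-A,\quad \widetilde E=\widetilde A-M_l,$$ $$\rho=\|(Q^TDQ)^{-1}Q^TD\|_2,\qquad \theta=\max(1,\|D\|_2,\|D^{-1}\|_2).$$ For $c,u_f>0$ let $\tilde\gamma^f_{mn}=\dfrac{c\,mn\,u_f}{1-mn\,u_f}$.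 We say that $(Q,\widehat R)$ is a QR factorization of $A$ computed in precision $u_f$ (with constant $c$) if $Q^TQ=I$, $\widehat R$ is upper triangular, and $A+E=Q\widehat R$ with $\|E\|_F\le\tilde\gamma^f_{mn}\|A\|_F$. The following hold. 1. If $Q^TQ=I$, then $\rho\le\kappa_2(D)^{1/2}$. 2. If $Q^TQ=I$, $\widehat R$ is invertible and $\alpha\ne0$, then $S=Q^TDQ$ and $M_l$ are invertible and $$M_l^{-1}=\begin{bmatrix}\frac1\alpha(D-DQS^{-1}Q^TD)&DQS^{-1}\widehat R^{-T}\\ \widehat R^{-1}S^{-1}Q^TD&-\alpha\widehat R^{-1}S^{-1}\widehat R^{-T}\end{bmatrix},$$ $$M_l^{-1}\widetilde E=\begin{bmatrix}-DQS^{-1}\widehat R^{-T}E^T&-\frac1\alpha(D-DQS^{-1}Q^TD)E\\ \alpha\widehat R^{-1}S^{-1}\widehat R^{-T}E^T&-\widehat R^{-1}S^{-1}Q^TDE\end{bmatrix}.$$ 3. For all $c>0$ and $K\ge0$ there are constants $\delta,C>0$, depending only on $m,n,c,K$, such that the following holds for all $A$, $D$ as above, all $u_f>0$, every QR factorization $(Q,\widehat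 R)$ of $A$ computed in precision $u_f$ with constant $c$, and every $\alpha$ with $\alpha\approx\pm\|A^\dagger\|_2^{-1}$ in the sense that $\bigl||\alpha|\,\|A^\dagger\|_2-1\bigr|\le K u_f$. Put $\eta=\rho\,\theta\,\kappa_\infty(A)\,u_f$. If $\eta\le\delta$ (for fixed $A$ and $D$ this holds for all sufficiently small $u_f$, by 1), then $\alpha\neq0$, the matrices $\widehat R$, $M_l$, $\widetilde A$ are invertible, and $$\|M_l^{-1}\widetilde E\|_\infty\le(\sqrt m+\sqrt n)\,\rho\,\theta\,\|A^\dagger\|_2\|E\|_F+C\eta^2,$$ $$\|M_l^{-1}\widetilde E\|_\infty\le 2m\sqrt n\,\rho\,\theta\,\tilde\gamma^f_{mn}\,\kappa_\infty(A)+C\eta^2,$$ $$\kappa_\infty(M_l^{-1}\widetilde A)\le\bigl(1+2m\sqrt n\,\rho\,\theta\,\tilde\gamma^f_{mn}\,\kappa_\infty(A)\bigr)^2+C\eta^2 .$$ 4. If $D=I$ and $Q^TQ=I$, then $\rho=\theta=1$. With the same $\delta,C$ and the same hypotheses on $c,K,A,Q,\widehat R,\alpha,u_f$ as in 3, if $\kappa_\infty(A)u_f\le\delta$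 then for $M=\begin{bmatrix}\alpha I&Q\widehat R\\ \widehat R^TQ^T&0\end{bmatrix}$ and $\widetilde A=\begin{bmatrix}\alpha I&A\\A^T&0\end{bmatrix}$, $$\kappa_\infty(M^{-1}\widetilde A)\le\bigl(1+2m\sqrt n\,\tilde\gamma^f_{mn}\,\kappa_\infty(A)\bigr)^2+C\,(\kappa_\infty(A)u_f)^2 .$$ -/

import Mathlib

open Matrix

noncomputable section

/-- The induced `∞`-norm (maximum absolute row sum). -/
def infNorm {ι κ : Type*} [Fintype ι] [Fintype κ] (M : Matrix ι κ ℝ) : ℝ :=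
  letI := Matrix.linftyOpNormedAddCommGroup (m := ι) (n := κ) (α := ℝ)
  ‖M‖

/-- The spectral norm (operator norm between Euclidean spaces). -/
def specNorm {ι κ : Type*} [Fintype ι] [Fintype κ] [DecidableEq κ] (M : Matrix ι κ ℝ) : ℝ :=
  letI := Matrix.instL2OpNormedAddCommGroup (𝕜 := ℝ) (m := ι) (n := κ)
  ‖M‖

/-- The Frobenius norm. -/
def frobNorm {ι κ : Type*} [Fintype ι] [Fintype κ] (M : Matrix ι κ ℝ) : ℝ :=
  letI := Matrix.frobeniusNormedAddCommGroup (m := ι) (n := κ) (α := ℝ)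
  ‖M‖

/-- The Moore–Penrose inverse `A† = (AᵀA)⁻¹Aᵀ` of a matrix of full column rank. It is used for such
matrices only; `pinv_penrose` verifies the four Penrose equations for them. -/
def pinv {m n : ℕ} (A : Matrix (Fin m) (Fin n) ℝ) : Matrix (Fin n) (Fin m) ℝ :=
  (Aᵀ * A)⁻¹ * Aᵀ

theorem pinv_penrose {m n : ℕ} (A : Matrix (Fin m) (Fin n) ℝ) (hA : A.rank = n) :
    A * pinv A * A = A ∧ pinv A * A * pinv A = pinv A ∧
      (A * pinv A)ᵀ = A * pinv A ∧ (pinv A * A)ᵀ = pinv A * A := by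
  have hu : IsUnit (Aᵀ * A) := by
    rw [Matrix.isUnit_iff_isUnit_det, isUnit_iff_ne_zero]
    intro h0
    obtain ⟨v, hv, hv0⟩ := Matrix.exists_mulVec_eq_zero_iff.mpr h0
    have hk : LinearMap.ker A.mulVecLin = ⊥ := by
      have h1 := LinearMap.finrank_range_add_finrank_ker A.mulVecLin
      have h2 : Module.finrank ℝ (LinearMap.range A.mulVecLin) = n := hA
      rw [h2, Module.finrank_fin_fun] at h1
      exact Submodule.finrank_eq_zero.mp (by omega)
    apply hv
    have h3 : A *ᵥ v = 0 := by
      have h4 : (A *ᵥ v) ⬝ᵥ (A *ᵥ v) = 0 := by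
        rw [Matrix.dotProduct_mulVec, Matrix.vecMul_mulVec, ← Matrix.dotProduct_mulVec, hv0]
        simp
      exact dotProduct_self_eq_zero.mp h4
    have h5 : v ∈ LinearMap.ker A.mulVecLin := by simpa using h3
    simpa [hk] using h5
  have hd := (Matrix.isUnit_iff_isUnit_det _).mp hu
  have hl : pinv A * A = 1 := by
    rw [pinv, Matrix.mul_assoc, Matrix.nonsing_inv_mul _ hd]
  refine ⟨by rw [Matrix.mul_assoc, hl, Matrix.mul_one], by rw [hl, Matrix.one_mul], ?_, ?_⟩
  · simp [pinv, Matrix.transpose_mul, Matrix.transpose_nonsing_inv, Matrix.mul_assoc]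
  · rw [hl, Matrix.transpose_one]

/-- `κ∞(A) = ‖A‖∞ ‖A†‖∞` for a rectangular matrix of full column rank. -/
def condInfRect {m n : ℕ} (A : Matrix (Fin m) (Fin n) ℝ) : ℝ :=
  infNorm A * infNorm (pinv A)

/-- `κ∞(X) = ‖X‖∞ ‖X⁻¹‖∞` for an invertible square matrix. -/
def condInf {ι : Type*} [Fintype ι] [DecidableEq ι] (X : Matrix ι ι ℝ) : ℝ :=
  infNorm X * infNorm X⁻¹

/-- `κ₂(X) = ‖X‖₂ ‖X⁻¹‖₂` for an invertible square matrix. -/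
def condTwo {ι : Type*} [Fintype ι] [DecidableEq ι] (X : Matrix ι ι ℝ) : ℝ :=
  specNorm X * specNorm X⁻¹

/-- The backward error constant `c m n u / (1 - m n u)` of a factorization in precision `u`. -/
def gammaTilde (c : ℝ) (m n : ℕ) (u : ℝ) : ℝ :=
  c * m * n * u / (1 - m * n * u)

/-- The error `E` of an approximate factorization, so that `A + E = Q R`. -/
def qrError {m n : ℕ} (A Q : Matrix (Fin m) (Fin n) ℝ) (R : Matrix (Fin n) (Fin n) ℝ) :
    Matrix (Fin m) (Fin n) ℝ :=
  Q * R - A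

/-- `Q`, `R` is a (thin) QR factorization of `A` computed in precision `u`: `Q` has orthonormal
columns, `R` is upper triangular, and `A + E = Q R` with `‖E‖_F ≤ γ̃ ‖A‖_F`. -/
structure IsComputedQR {m n : ℕ} (c u : ℝ) (A Q : Matrix (Fin m) (Fin n) ℝ)
    (R : Matrix (Fin n) (Fin n) ℝ) : Prop where
  orthonormal : Qᵀ * Q = 1
  upperTriangular : R.BlockTriangular id
  backward : frobNorm (qrError A Q R) ≤ gammaTilde c m n u * frobNorm A

/-- The augmented matrix `Ã = [αD⁻¹, A; Aᵀ, 0]`. -/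
def augMatrix {m n : ℕ} (α : ℝ) (D : Matrix (Fin m) (Fin m) ℝ) (A : Matrix (Fin m) (Fin n) ℝ) :
    Matrix (Fin m ⊕ Fin n) (Fin m ⊕ Fin n) ℝ :=
  fromBlocks (α • D⁻¹) A Aᵀ 0

/-- The left preconditioner `M_l = [αD⁻¹, QR; RᵀQᵀ, 0]`. -/
def leftPrecond {m n : ℕ} (α : ℝ) (D : Matrix (Fin m) (Fin m) ℝ) (Q : Matrix (Fin m) (Fin n) ℝ)
    (R : Matrix (Fin n) (Fin n) ℝ) : Matrix (Fin m ⊕ Fin n) (Fin m ⊕ Fin n) ℝ :=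
  fromBlocks (α • D⁻¹) (Q * R) (Rᵀ * Qᵀ) 0

/-- `Ẽ = Ã - M_l`. -/
def augError {m n : ℕ} (α : ℝ) (D : Matrix (Fin m) (Fin m) ℝ) (A Q : Matrix (Fin m) (Fin n) ℝ)
    (R : Matrix (Fin n) (Fin n) ℝ) : Matrix (Fin m ⊕ Fin n) (Fin m ⊕ Fin n) ℝ :=
  augMatrix α D A - leftPrecond α D Q R

/-- `ρ = ‖(QᵀDQ)⁻¹QᵀD‖₂`, the spectral norm of the weighted pseudoinverse of `Q`. -/
def rhoWeight {m n : ℕ} (D : Matrix (Fin m) (Fin m) ℝ) (Q : Matrix (Fin m) (Fin n) ℝ) : ℝ :=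
  specNorm ((Qᵀ * D * Q)⁻¹ * Qᵀ * D)

/-- `θ = max(1, ‖D‖₂, ‖D⁻¹‖₂)`. -/
def thetaWeight {m : ℕ} (D : Matrix (Fin m) (Fin m) ℝ) : ℝ :=
  max 1 (max (specNorm D) (specNorm D⁻¹))

end

/-! Put `H = D^{1/2}`, `W = HQ`, `S = QᵀDQ = WᵀW`, and let `P = W S⁻¹ Wᵀ` be the orthogonal
projection onto the range of `W`. Since `S⁻¹Wᵀ = QᵀH⁻¹P`, and `Qᵀ` and `P` are contractions,
`‖S⁻¹Wᵀ‖₂ ≤ ‖H⁻¹‖₂`. This one estimate (`specNorm_weighted_pinv_le`) gives `ρ ≤ ‖H‖₂‖H⁻¹‖₂ =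
κ₂(D)^{1/2}` and `‖S⁻¹‖₂ ≤ ‖D⁻¹‖₂`; contractivity of `1 - P` gives `‖D - DQS⁻¹QᵀD‖₂ ≤ ‖D‖₂`. Hence
every weight factor in the blocks of `M_l⁻¹Ẽ` is at most `ρ` or `θ`, and so at most `ρθ`, both being
at least 1.

What remains in each block is scalar. From `A†QR = 1 + A†E` follows `‖R⁻¹‖₂ ≤ ‖A†‖₂/(1 - x)` with `x
= ‖A†‖₂‖E‖_F`. As `|α|‖A†‖₂` is close to 1, the quantities `‖R⁻¹‖‖E‖`, `‖E‖/|α|` and `|α|‖R⁻¹‖²‖E‖`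
are all `x` up to second order. Each block row has `m + n` columns, split as `m` and `n`, so passing
to the `∞`-norm costs `√m + √n`.

Finally `x ≤ √m √n γ̃ κ∞(A)`, which turns the first bound into the second, and `M_l⁻¹Ã = 1 + G` with
`G = M_l⁻¹Ẽ` small, so that `κ∞(1 + G) ≤ (1 + ‖G‖)/(1 - ‖G‖)` gives the third. -/

/-! ### Comparison of the three norms, and perturbations of the identity -/

section Norms

variable {ι κ μ : Type*} [Fintype ι] [Fintype κ] [Fintype μ]

theorem infNorm_nonneg (X : Matrix ι κ ℝ) : 0 ≤ infNorm X := by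
  let _ := Matrix.linftyOpNormedAddCommGroup (m := ι) (n := κ) (α := ℝ)
  exact norm_nonneg X

theorem infNorm_le_of_row_sum_le {X : Matrix ι κ ℝ} {t : ℝ} (ht : 0 ≤ t)
    (h : ∀ i, ∑ j, |X i j| ≤ t) : infNorm X ≤ t := by
  let _ := Matrix.linftyOpNormedAddCommGroup (m := ι) (n := κ) (α := ℝ)
  change ‖X‖ ≤ t
  lift t to NNReal using ht
  rw [Matrix.linfty_opNorm_def]
  norm_cast
  refine Finset.sup_le fun i _ => ?_
  rw [← NNReal.coe_le_coe]
  simpa using h i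

theorem row_sum_le_infNorm (X : Matrix ι κ ℝ) (i : ι) : ∑ j, |X i j| ≤ infNorm X := by
  let _ := Matrix.linftyOpNormedAddCommGroup (m := ι) (n := κ) (α := ℝ)
  change _ ≤ ‖X‖
  rw [Matrix.linfty_opNorm_def]
  have h := Finset.le_sup (f := fun i : ι => ∑ j : κ, ‖X i j‖₊) (Finset.mem_univ i)
  rw [← NNReal.coe_le_coe] at h
  simpa using h

theorem infNorm_mul_le (X : Matrix ι κ ℝ) (Y : Matrix κ μ ℝ) :
    infNorm (X * Y) ≤ infNorm X * infNorm Y :=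
  Matrix.linfty_opNorm_mul X Y

theorem infNorm_one_le [DecidableEq ι] : infNorm (1 : Matrix ι ι ℝ) ≤ 1 := by
  refine infNorm_le_of_row_sum_le zero_le_one fun i => ?_
  simp [Matrix.one_apply, apply_ite abs]

theorem infNorm_one [DecidableEq ι] [Nonempty ι] : infNorm (1 : Matrix ι ι ℝ) = 1 := by
  refine le_antisymm infNorm_one_le ?_
  have h := row_sum_le_infNorm (1 : Matrix ι ι ℝ) (Classical.arbitrary ι)
  simpa [Matrix.one_apply, apply_ite abs] using h

theorem infNorm_add_le (X Y : Matrix ι κ ℝ) : infNorm (X + Y) ≤ infNorm X + infNorm Y := by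
  let _ := Matrix.linftyOpNormedAddCommGroup (m := ι) (n := κ) (α := ℝ)
  exact norm_add_le X Y

theorem infNorm_neg (X : Matrix ι κ ℝ) : infNorm (-X) = infNorm X := by
  let _ := Matrix.linftyOpNormedAddCommGroup (m := ι) (n := κ) (α := ℝ)
  exact norm_neg X

theorem infNorm_fromBlocks_le {ν : Type*} [Fintype ν] (A : Matrix ι κ ℝ) (B : Matrix ι μ ℝ)
    (C : Matrix ν κ ℝ) (D : Matrix ν μ ℝ) {t : ℝ} (h₁ : infNorm A + infNorm B ≤ t)
    (h₂ : infNorm C + infNorm D ≤ t) : infNorm (fromBlocks A B C D) ≤ t := by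
  have ht : 0 ≤ t := le_trans (add_nonneg (infNorm_nonneg A) (infNorm_nonneg B)) h₁
  refine infNorm_le_of_row_sum_le ht ?_
  rintro (i | i)
  · simpa using (add_le_add (row_sum_le_infNorm A i) (row_sum_le_infNorm B i)).trans h₁
  · simpa using (add_le_add (row_sum_le_infNorm C i) (row_sum_le_infNorm D i)).trans h₂

theorem frobNorm_sq (X : Matrix ι κ ℝ) : frobNorm X ^ 2 = ∑ i, ∑ j, X i j ^ 2 := by
  let _ := Matrix.frobeniusNormedAddCommGroup (m := ι) (n := κ) (α := ℝ)
  change ‖X‖ ^ 2 = _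
  rw [Matrix.frobenius_norm_def, ← Real.sqrt_eq_rpow, Real.sq_sqrt (by positivity)]
  simp

theorem frobNorm_nonneg (X : Matrix ι κ ℝ) : 0 ≤ frobNorm X := by
  let _ := Matrix.frobeniusNormedAddCommGroup (m := ι) (n := κ) (α := ℝ)
  exact norm_nonneg X

theorem frobNorm_le_sqrt_card_mul_infNorm (X : Matrix ι κ ℝ) :
    frobNorm X ≤ Real.sqrt (Fintype.card ι) * infNorm X := by
  refine le_of_sq_le_sq ?_ (mul_nonneg (Real.sqrt_nonneg _) (infNorm_nonneg X))
  rw [frobNorm_sq, mul_pow, Real.sq_sqrt (Nat.cast_nonneg _)]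
  calc ∑ i, ∑ j, X i j ^ 2 ≤ ∑ _i : ι, infNorm X ^ 2 := by
        refine Finset.sum_le_sum fun i _ => ?_
        calc ∑ j, X i j ^ 2 = ∑ j, |X i j| ^ 2 := by simp
          _ ≤ (∑ j, |X i j|) ^ 2 :=
            Finset.sum_sq_le_sq_sum_of_nonneg fun j _ => abs_nonneg _
          _ ≤ infNorm X ^ 2 :=
            pow_le_pow_left₀ (Finset.sum_nonneg fun j _ => abs_nonneg _) (row_sum_le_infNorm X i) 2
    _ = Fintype.card ι * infNorm X ^ 2 := by simp

variable [DecidableEq κ]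

theorem specNorm_nonneg (X : Matrix ι κ ℝ) : 0 ≤ specNorm X := by
  let _ := Matrix.instL2OpNormedAddCommGroup (𝕜 := ℝ) (m := ι) (n := κ)
  exact norm_nonneg X

theorem specNorm_mul_le [DecidableEq μ] (X : Matrix ι κ ℝ) (Y : Matrix κ μ ℝ) :
    specNorm (X * Y) ≤ specNorm X * specNorm Y :=
  Matrix.l2_opNorm_mul X Y

theorem specNorm_transpose [DecidableEq ι] (X : Matrix ι κ ℝ) : specNorm Xᵀ = specNorm X := by
  rw [← Matrix.conjTranspose_eq_transpose_of_trivial]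
  exact Matrix.l2_opNorm_conjTranspose X

theorem specNorm_transpose_mul_self (X : Matrix ι κ ℝ) : specNorm (Xᵀ * X) = specNorm X ^ 2 := by
  rw [← Matrix.conjTranspose_eq_transpose_of_trivial, sq]
  exact Matrix.l2_opNorm_conjTranspose_mul_self X

theorem specNorm_smul (a : ℝ) (X : Matrix ι κ ℝ) : specNorm (a • X) = |a| * specNorm X := by
  let _ := Matrix.instL2OpNormedAddCommGroup (𝕜 := ℝ) (m := ι) (n := κ)
  let _ := Matrix.instL2OpNormedSpace (𝕜 := ℝ) (m := ι) (n := κ)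
  exact norm_smul a X

theorem specNorm_neg (X : Matrix ι κ ℝ) : specNorm (-X) = specNorm X := by
  let _ := Matrix.instL2OpNormedAddCommGroup (𝕜 := ℝ) (m := ι) (n := κ)
  exact norm_neg X

theorem specNorm_add_le (X Y : Matrix ι κ ℝ) : specNorm (X + Y) ≤ specNorm X + specNorm Y := by
  let _ := Matrix.instL2OpNormedAddCommGroup (𝕜 := ℝ) (m := ι) (n := κ)
  exact norm_add_le X Y

theorem specNorm_one [Nonempty κ] : specNorm (1 : Matrix κ κ ℝ) = 1 := by
  let _ := Matrix.instL2OpNormedAddCommGroup (𝕜 := ℝ) (m := κ) (n := κ)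
  have h := specNorm_transpose_mul_self (1 : Matrix κ κ ℝ)
  rw [Matrix.transpose_one, Matrix.one_mul, sq] at h
  have h0 : specNorm (1 : Matrix κ κ ℝ) ≠ 0 := fun h0 => one_ne_zero (norm_eq_zero.mp h0)
  exact (mul_left_cancel₀ h0 ((mul_one _).trans h)).symm

theorem sum_sq_mulVec_le (X : Matrix ι κ ℝ) (v : κ → ℝ) :
    ∑ i, (X *ᵥ v) i ^ 2 ≤ specNorm X ^ 2 * ∑ j, v j ^ 2 := by
  have h := Matrix.l2_opNorm_mulVec X (WithLp.toLp 2 v)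
  have h2 := pow_le_pow_left₀ (norm_nonneg _) h 2
  rw [mul_pow, EuclideanSpace.norm_sq_eq, EuclideanSpace.norm_sq_eq] at h2
  simp only [Real.norm_eq_abs, sq_abs] at h2
  exact h2

theorem specNorm_le_frobNorm (X : Matrix ι κ ℝ) : specNorm X ≤ frobNorm X := by
  let _ := Matrix.instL2OpNormedAddCommGroup (𝕜 := ℝ) (m := ι) (n := κ)
  change ‖X‖ ≤ _
  rw [Matrix.l2_opNorm_def]
  refine ContinuousLinearMap.opNorm_le_bound _ (frobNorm_nonneg X) fun v => ?_
  refine le_of_sq_le_sq ?_ (mul_nonneg (frobNorm_nonneg X) (norm_nonneg v))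
  rw [mul_pow, frobNorm_sq, EuclideanSpace.norm_sq_eq, EuclideanSpace.norm_sq_eq, Finset.sum_mul]
  refine Finset.sum_le_sum fun i _ => ?_
  simpa [Matrix.mulVec, dotProduct] using
    Finset.sum_mul_sq_le_sq_mul_sq Finset.univ (fun j => X i j) (fun j => v j)

theorem specNorm_le_sqrt_card_mul_infNorm (X : Matrix ι κ ℝ) :
    specNorm X ≤ Real.sqrt (Fintype.card ι) * infNorm X :=
  (specNorm_le_frobNorm X).trans (frobNorm_le_sqrt_card_mul_infNorm X)

/-- The absolute sum of row `i` is the `i`-th entry of `X s`, where `s` is the sign vector of that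
row; `s` has squared Euclidean length equal to the number of columns. -/
theorem infNorm_le_sqrt_card_mul_specNorm (X : Matrix ι κ ℝ) :
    infNorm X ≤ Real.sqrt (Fintype.card κ) * specNorm X := by
  have hnn : 0 ≤ Real.sqrt (Fintype.card κ) * specNorm X :=
    mul_nonneg (Real.sqrt_nonneg _) (specNorm_nonneg X)
  refine infNorm_le_of_row_sum_le hnn fun i => ?_
  let s : κ → ℝ := fun j => if 0 ≤ X i j then 1 else -1
  have hs : ∑ j, |X i j| = (X *ᵥ s) i := by
    refine Finset.sum_congr rfl fun j _ => ?_
    by_cases h : 0 ≤ X i j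
    · simp [s, h, abs_of_nonneg]
    · simp [s, h, abs_of_neg (not_le.mp h)]
  have hs2 : ∀ j, s j ^ 2 = 1 := fun j => by by_cases h : 0 ≤ X i j <;> simp [s, h]
  rw [hs]
  refine le_of_sq_le_sq ?_ hnn
  rw [mul_pow, Real.sq_sqrt (Nat.cast_nonneg _)]
  calc (X *ᵥ s) i ^ 2 ≤ ∑ k, (X *ᵥ s) k ^ 2 :=
        Finset.single_le_sum (f := fun k => (X *ᵥ s) k ^ 2) (fun k _ => sq_nonneg _)
          (Finset.mem_univ i)
    _ ≤ specNorm X ^ 2 * ∑ j, s j ^ 2 := sum_sq_mulVec_le X s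
    _ = Fintype.card κ * specNorm X ^ 2 := by simp [hs2, mul_comm]

theorem specNorm_le_one_of_orthonormal {Q : Matrix ι κ ℝ} (hQ : Qᵀ * Q = 1) : specNorm Q ≤ 1 := by
  have h := specNorm_transpose_mul_self Q
  have h1 := specNorm_transpose_mul_self (1 : Matrix κ κ ℝ)
  rw [hQ] at h
  rw [Matrix.transpose_one, Matrix.one_mul] at h1
  have h2 : specNorm (1 : Matrix κ κ ℝ) ≤ 1 := by
    nlinarith [specNorm_nonneg (1 : Matrix κ κ ℝ)]
  nlinarith [specNorm_nonneg Q]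

/-- For an orthogonal projection the C*-identity reads `‖P‖ = ‖P‖²`. -/
theorem specNorm_le_one_of_isSymm_of_mul_self {P : Matrix κ κ ℝ} (hs : Pᵀ = P) (hP : P * P = P) :
    specNorm P ≤ 1 := by
  have h := specNorm_transpose_mul_self P
  rw [hs, hP] at h
  nlinarith [specNorm_nonneg P]

theorem isUnit_one_add_of_specNorm_lt_one {F : Matrix κ κ ℝ} (h : specNorm F < 1) :
    IsUnit (1 + F) := by
  let _ := Matrix.instL2OpNormedRing (𝕜 := ℝ) (n := κ)
  let _ := Matrix.instL2OpNormedSpace (𝕜 := ℝ) (m := κ) (n := κ)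
  have : CompleteSpace (Matrix κ κ ℝ) := FiniteDimensional.complete ℝ _
  have h' : ‖-F‖ < 1 := by rw [norm_neg]; exact h
  simpa using isUnit_one_sub_of_norm_lt_one h'

theorem isUnit_one_add_of_infNorm_lt_one {F : Matrix κ κ ℝ} (h : infNorm F < 1) :
    IsUnit (1 + F) := by
  let _ := Matrix.linftyOpNormedRing (n := κ) (α := ℝ)
  let _ := Matrix.linftyOpNormedSpace (R := ℝ) (m := κ) (n := κ) (α := ℝ)
  have : CompleteSpace (Matrix κ κ ℝ) := FiniteDimensional.complete ℝ _
  have h' : ‖-F‖ < 1 := by rw [norm_neg]; exact h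
  simpa using isUnit_one_sub_of_norm_lt_one h'

/-- Taking norms here and solving for `‖(1 + F)⁻¹‖` yields the Neumann bound without summing a
series. -/
theorem inv_one_add_eq {F : Matrix κ κ ℝ} (h : IsUnit (1 + F)) :
    (1 + F)⁻¹ = 1 + -(F * (1 + F)⁻¹) := by
  have h1 := Matrix.mul_nonsing_inv _ ((Matrix.isUnit_iff_isUnit_det _).mp h)
  rw [Matrix.add_mul, Matrix.one_mul] at h1
  exact (eq_sub_of_add_eq h1).trans (sub_eq_add_neg _ _)

theorem specNorm_inv_one_add_le [Nonempty κ] {F : Matrix κ κ ℝ} (h : specNorm F < 1) :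
    specNorm (1 + F)⁻¹ ≤ (1 - specNorm F)⁻¹ := by
  have h1 := congrArg specNorm (inv_one_add_eq (isUnit_one_add_of_specNorm_lt_one h))
  have h2 := specNorm_add_le 1 (-(F * (1 + F)⁻¹))
  rw [specNorm_neg, specNorm_one] at h2
  have h3 := specNorm_mul_le F (1 + F)⁻¹
  rw [inv_eq_one_div (1 - _), le_div_iff₀ (sub_pos.mpr h)]
  linarith

theorem infNorm_inv_one_add_le {F : Matrix κ κ ℝ} (h : infNorm F < 1) :
    infNorm (1 + F)⁻¹ ≤ (1 - infNorm F)⁻¹ := by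
  have h1 := congrArg infNorm (inv_one_add_eq (isUnit_one_add_of_infNorm_lt_one h))
  have h2 := infNorm_add_le 1 (-(F * (1 + F)⁻¹))
  rw [infNorm_neg] at h2
  have h3 := infNorm_mul_le F (1 + F)⁻¹
  have h4 := infNorm_one_le (ι := κ)
  rw [inv_eq_one_div (1 - _), le_div_iff₀ (sub_pos.mpr h)]
  linarith

/-- With `f = ‖F‖∞`, `(1 + f)/(1 - f) = 1 + 2f + 2f²/(1 - f)`, and `1 - f ≥ 1/2`. -/
theorem condInf_one_add_le {F : Matrix κ κ ℝ} (h : infNorm F ≤ 1 / 2) :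
    condInf (1 + F) ≤ 1 + 2 * infNorm F + 4 * infNorm F ^ 2 := by
  have h0 := infNorm_nonneg F
  have h1 : infNorm (1 + F) ≤ 1 + infNorm F :=
    (infNorm_add_le 1 F).trans (by linarith [infNorm_one_le (ι := κ)])
  have h2 := infNorm_inv_one_add_le (F := F) (by linarith)
  calc condInf (1 + F) ≤ (1 + infNorm F) * (1 - infNorm F)⁻¹ :=
        mul_le_mul h1 h2 (infNorm_nonneg _) (by linarith)
    _ ≤ 1 + 2 * infNorm F + 4 * infNorm F ^ 2 := by
        rw [← div_eq_mul_inv, div_le_iff₀ (by linarith)]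
        nlinarith [mul_nonneg (sq_nonneg (infNorm F)) (by linarith : 0 ≤ 1 - 2 * infNorm F)]

end Norms

/-! ### The weighted Gram matrix and its orthogonal projection -/

section Weighted

variable {ι κ : Type*} [Fintype ι] [DecidableEq ι]

theorem diagonal_inv_mul_cancel {d : ι → ℝ} (hd : ∀ i, 0 < d i) :
    (diagonal d)⁻¹ * diagonal d = 1 := by
  refine Matrix.nonsing_inv_mul _ ?_
  rw [Matrix.det_diagonal, isUnit_iff_ne_zero]
  exact Finset.prod_ne_zero_iff.mpr fun i _ => (hd i).ne'

theorem diagonal_sqrt_mul_self {d : ι → ℝ} (hd : ∀ i, 0 < d i) :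
    diagonal (fun i => Real.sqrt (d i)) * diagonal (fun i => Real.sqrt (d i)) = diagonal d := by
  rw [Matrix.diagonal_mul_diagonal]
  exact congrArg diagonal (funext fun i => Real.mul_self_sqrt (hd i).le)

theorem specNorm_diagonal_sqrt_sq {d : ι → ℝ} (hd : ∀ i, 0 < d i) :
    specNorm (diagonal fun i => Real.sqrt (d i)) ^ 2 = specNorm (diagonal d) := by
  rw [← specNorm_transpose_mul_self, Matrix.diagonal_transpose, diagonal_sqrt_mul_self hd]

theorem specNorm_inv_diagonal_sqrt_sq {d : ι → ℝ} (hd : ∀ i, 0 < d i) :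
    specNorm (diagonal fun i => Real.sqrt (d i))⁻¹ ^ 2 = specNorm (diagonal d)⁻¹ := by
  rw [← specNorm_transpose_mul_self, Matrix.transpose_nonsing_inv, Matrix.diagonal_transpose,
    ← Matrix.mul_inv_rev, diagonal_sqrt_mul_self hd]

theorem weighted_gram_eq {d : ι → ℝ} (hd : ∀ i, 0 < d i) (Q : Matrix ι κ ℝ) :
    Qᵀ * diagonal d * Q = (diagonal (fun i => Real.sqrt (d i)) * Q)ᵀ *
      (diagonal (fun i => Real.sqrt (d i)) * Q) := by
  rw [← diagonal_sqrt_mul_self hd, Matrix.transpose_mul, Matrix.diagonal_transpose]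
  simp only [Matrix.mul_assoc]

variable [Fintype κ] [DecidableEq κ]

theorem isUnit_of_mulVec_eq_zero {S : Matrix κ κ ℝ} (h : ∀ v, S *ᵥ v = 0 → v = 0) : IsUnit S := by
  rw [Matrix.isUnit_iff_isUnit_det, isUnit_iff_ne_zero]
  intro h0
  obtain ⟨v, hv, hv0⟩ := Matrix.exists_mulVec_eq_zero_iff.mpr h0
  exact hv (h v hv0)

theorem isUnit_transpose_mul_self {ι : Type*} [Fintype ι] {W : Matrix ι κ ℝ} {Y : Matrix κ ι ℝ} (h : Y * W = 1) :
    IsUnit (Wᵀ * W) := by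
  refine isUnit_of_mulVec_eq_zero fun v hv => ?_
  have h4 : (W *ᵥ v) ⬝ᵥ (W *ᵥ v) = 0 := by
    rw [Matrix.dotProduct_mulVec, Matrix.vecMul_mulVec, ← Matrix.dotProduct_mulVec, hv]
    simp
  have h5 := congrArg (fun w => Y *ᵥ w) (dotProduct_self_eq_zero.mp h4)
  simpa [Matrix.mulVec_mulVec, h] using h5

theorem isUnit_weighted_gram {d : ι → ℝ} (hd : ∀ i, 0 < d i) {Q : Matrix ι κ ℝ}
    (hQ : Qᵀ * Q = 1) : IsUnit (Qᵀ * diagonal d * Q) := by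
  have h := diagonal_inv_mul_cancel (d := fun i => Real.sqrt (d i)) fun i => Real.sqrt_pos.mpr (hd i)
  rw [weighted_gram_eq hd]
  refine isUnit_transpose_mul_self (Y := Qᵀ * (diagonal fun i => Real.sqrt (d i))⁻¹) ?_
  rw [Matrix.mul_assoc, ← Matrix.mul_assoc _ _ Q, h, Matrix.one_mul, hQ]

/-- With `H = D^{1/2}`, `W = H Q` and `P = W (Wᵀ W)⁻¹ Wᵀ` the orthogonal projection onto the range
of `W`, the matrix `(Wᵀ W)⁻¹ Wᵀ` is `Qᵀ H⁻¹ P`. -/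
theorem specNorm_weighted_pinv_le {d : ι → ℝ} (hd : ∀ i, 0 < d i) {Q : Matrix ι κ ℝ}
    (hQ : Qᵀ * Q = 1) :
    specNorm ((Qᵀ * diagonal d * Q)⁻¹ * (diagonal (fun i => Real.sqrt (d i)) * Q)ᵀ) ≤
        specNorm (diagonal fun i => Real.sqrt (d i))⁻¹ ∧
      specNorm (1 - diagonal (fun i => Real.sqrt (d i)) * Q *
        ((Qᵀ * diagonal d * Q)⁻¹ * (diagonal (fun i => Real.sqrt (d i)) * Q)ᵀ)) ≤ 1 := by
  have hS := (Matrix.isUnit_iff_isUnit_det _).mp (isUnit_weighted_gram hd hQ)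
  have hH := diagonal_inv_mul_cancel (d := fun i => Real.sqrt (d i)) fun i => Real.sqrt_pos.mpr (hd i)
  rw [weighted_gram_eq hd] at hS ⊢
  set H := diagonal fun i => Real.sqrt (d i)
  set W := H * Q with hW
  set Z := (Wᵀ * W)⁻¹ * Wᵀ with hZ
  have hZW : Z * W = 1 := by rw [hZ, Matrix.mul_assoc, Matrix.nonsing_inv_mul _ hS]
  have hPs : (W * Z)ᵀ = W * Z := by
    simp [hZ, Matrix.transpose_mul, Matrix.transpose_nonsing_inv, Matrix.mul_assoc]
  have hPP : W * Z * (W * Z) = W * Z := by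
    rw [Matrix.mul_assoc, ← Matrix.mul_assoc Z, hZW, Matrix.one_mul]
  -- Insert `QᵀQ = 1` and `H⁻¹H = 1` in front of `Z`, then regroup `HQ` as `W`.
  have hZ' : Z = Qᵀ * H⁻¹ * (W * Z) := by
    calc Z = Qᵀ * ((H⁻¹ * H) * (Q * Z)) := by
          rw [hH, Matrix.one_mul, ← Matrix.mul_assoc, hQ, Matrix.one_mul]
      _ = Qᵀ * H⁻¹ * (W * Z) := by simp only [hW, Matrix.mul_assoc]
  constructor
  · have h1 : specNorm Qᵀ ≤ 1 := (specNorm_transpose Q).le.trans (specNorm_le_one_of_orthonormal hQ)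
    calc specNorm Z = specNorm (Qᵀ * H⁻¹ * (W * Z)) := congrArg specNorm hZ'
      _ ≤ specNorm (Qᵀ * H⁻¹) * specNorm (W * Z) := specNorm_mul_le _ _
      _ ≤ specNorm (Qᵀ * H⁻¹) * 1 := mul_le_mul_of_nonneg_left
          (specNorm_le_one_of_isSymm_of_mul_self hPs hPP) (specNorm_nonneg _)
      _ ≤ specNorm Qᵀ * specNorm H⁻¹ := by rw [mul_one]; exact specNorm_mul_le _ _
      _ ≤ 1 * specNorm H⁻¹ := mul_le_mul_of_nonneg_right h1 (specNorm_nonneg _)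
      _ = specNorm H⁻¹ := one_mul _
  · refine specNorm_le_one_of_isSymm_of_mul_self ?_ ?_
    · rw [Matrix.transpose_sub, Matrix.transpose_one, hPs]
    · rw [Matrix.sub_mul, Matrix.one_mul, Matrix.mul_sub, Matrix.mul_one, hPP, sub_self, sub_zero]

/-- With `Z = S⁻¹Wᵀ` one has `S⁻¹ = Z Zᵀ`, so its norm is `‖Z‖² ≤ ‖H⁻¹‖² = ‖D⁻¹‖`. -/
theorem specNorm_inv_weighted_gram_le {d : ι → ℝ} (hd : ∀ i, 0 < d i) {Q : Matrix ι κ ℝ}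
    (hQ : Qᵀ * Q = 1) :
    specNorm (Qᵀ * diagonal d * Q)⁻¹ ≤ specNorm (diagonal d)⁻¹ := by
  have hS := (Matrix.isUnit_iff_isUnit_det _).mp (isUnit_weighted_gram hd hQ)
  have h := (specNorm_weighted_pinv_le hd hQ).1
  rw [weighted_gram_eq hd] at hS h ⊢
  generalize diagonal (fun i => Real.sqrt (d i)) * Q = W at hS h ⊢
  have h1 : (Wᵀ * W)⁻¹ = ((Wᵀ * W)⁻¹ * Wᵀ)ᵀᵀ * ((Wᵀ * W)⁻¹ * Wᵀ)ᵀ := by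
    rw [Matrix.transpose_transpose, Matrix.transpose_mul, Matrix.transpose_transpose,
      Matrix.transpose_nonsing_inv, Matrix.transpose_mul, Matrix.transpose_transpose,
      Matrix.mul_assoc, ← Matrix.mul_assoc Wᵀ, Matrix.mul_nonsing_inv _ hS, Matrix.mul_one]
  rw [h1, specNorm_transpose_mul_self, specNorm_transpose, ← specNorm_inv_diagonal_sqrt_sq hd]
  exact pow_le_pow_left₀ (specNorm_nonneg _) h 2

/-- The matrix equals `H (1 - P) H`, and `1 - P` is a contraction. -/
theorem specNorm_weighted_complement_le {d : ι → ℝ} (hd : ∀ i, 0 < d i) {Q : Matrix ι κ ℝ}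
    (hQ : Qᵀ * Q = 1) :
    specNorm (diagonal d - diagonal d * Q * (Qᵀ * diagonal d * Q)⁻¹ * Qᵀ * diagonal d) ≤
      specNorm (diagonal d) := by
  have h := (specNorm_weighted_pinv_le hd hQ).2
  set S := Qᵀ * diagonal d * Q
  have hsq := specNorm_diagonal_sqrt_sq hd
  have hm := diagonal_sqrt_mul_self hd
  have hT : (diagonal fun i => Real.sqrt (d i))ᵀ = diagonal fun i => Real.sqrt (d i) :=
    Matrix.diagonal_transpose _
  set H := diagonal fun i => Real.sqrt (d i)
  have h1 : diagonal d - diagonal d * Q * S⁻¹ * Qᵀ * diagonal d =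
      H * (1 - H * Q * (S⁻¹ * (H * Q)ᵀ)) * H := by
    rw [Matrix.transpose_mul, hT, ← hm]
    simp only [Matrix.mul_sub, Matrix.sub_mul, Matrix.mul_assoc, Matrix.one_mul]
  rw [h1, ← hsq, sq]
  calc specNorm (H * (1 - H * Q * (S⁻¹ * (H * Q)ᵀ)) * H)
      ≤ specNorm (H * (1 - H * Q * (S⁻¹ * (H * Q)ᵀ))) * specNorm H := specNorm_mul_le _ _
    _ ≤ specNorm H * specNorm H := mul_le_mul_of_nonneg_right
        ((specNorm_mul_le _ _).trans (mul_le_of_le_one_right (specNorm_nonneg _) h))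
        (specNorm_nonneg _)

end Weighted

/-! ### The parameters `ρ` and `θ` -/

section Parameters

variable {m n : ℕ}

theorem rhoWeight_le_sqrt_condTwo {d : Fin m → ℝ} (hd : ∀ i, 0 < d i)
    {Q : Matrix (Fin m) (Fin n) ℝ} (hQ : Qᵀ * Q = 1) :
    rhoWeight (diagonal d) Q ≤ Real.sqrt (condTwo (diagonal d)) := by
  have h := (specNorm_weighted_pinv_le hd hQ).1
  have hs := specNorm_diagonal_sqrt_sq hd
  have hi := specNorm_inv_diagonal_sqrt_sq hd
  have hm := diagonal_sqrt_mul_self hd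
  have hT : (diagonal fun i => Real.sqrt (d i))ᵀ = diagonal fun i => Real.sqrt (d i) :=
    Matrix.diagonal_transpose _
  rw [rhoWeight, condTwo, ← hs, ← hi, mul_comm, ← mul_pow,
    Real.sqrt_sq (mul_nonneg (specNorm_nonneg _) (specNorm_nonneg _))]
  set S := Qᵀ * diagonal d * Q
  set H := diagonal fun i => Real.sqrt (d i)
  have h1 : S⁻¹ * Qᵀ * diagonal d = S⁻¹ * (H * Q)ᵀ * H := by
    rw [Matrix.transpose_mul, hT, ← hm]
    simp only [Matrix.mul_assoc]
  rw [h1]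
  exact (specNorm_mul_le _ _).trans (mul_le_mul_of_nonneg_right h (specNorm_nonneg _))

/-- `S⁻¹QᵀD` is a left inverse of `Q`, and `‖Q‖₂ ≤ 1`. Together with `θ ≥ 1` this lets `ρθ` dominate
both `ρ` and `θ`. -/
theorem one_le_rhoWeight (hn : 0 < n) {d : Fin m → ℝ} (hd : ∀ i, 0 < d i)
    {Q : Matrix (Fin m) (Fin n) ℝ} (hQ : Qᵀ * Q = 1) : 1 ≤ rhoWeight (diagonal d) Q := by
  have : Nonempty (Fin n) := ⟨⟨0, hn⟩⟩
  have hS := (Matrix.isUnit_iff_isUnit_det _).mp (isUnit_weighted_gram hd hQ)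
  have h : (Qᵀ * diagonal d * Q)⁻¹ * Qᵀ * diagonal d * Q = 1 := by
    rw [← Matrix.nonsing_inv_mul _ hS]
    simp only [Matrix.mul_assoc]
  rw [← specNorm_one (κ := Fin n), ← h]
  exact (specNorm_mul_le _ _).trans
    (mul_le_of_le_one_right (specNorm_nonneg _) (specNorm_le_one_of_orthonormal hQ))

theorem rhoWeight_one (hn : 0 < n) {Q : Matrix (Fin m) (Fin n) ℝ} (hQ : Qᵀ * Q = 1) :
    rhoWeight (1 : Matrix (Fin m) (Fin m) ℝ) Q = 1 := by
  refine le_antisymm ?_ ?_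
  · rw [rhoWeight, Matrix.mul_one, Matrix.mul_one, hQ, inv_one, Matrix.one_mul, specNorm_transpose]
    exact specNorm_le_one_of_orthonormal hQ
  · simpa using one_le_rhoWeight hn (d := fun _ => 1) (fun _ => one_pos) hQ

theorem thetaWeight_one (hm : 0 < m) : thetaWeight (1 : Matrix (Fin m) (Fin m) ℝ) = 1 := by
  have : Nonempty (Fin m) := ⟨⟨0, hm⟩⟩
  rw [thetaWeight, inv_one, specNorm_one, max_self, max_self]

end Parameters

/-! ### Block formulas for the preconditioner -/

section Preconditioner

variable {m n : ℕ}

theorem leftPrecond_mul_eq_one {D : Matrix (Fin m) (Fin m) ℝ} (hD : D⁻¹ * D = 1)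
    {Q : Matrix (Fin m) (Fin n) ℝ} {R S : Matrix (Fin n) (Fin n) ℝ}
    (hR : IsUnit R) (hS : S = Qᵀ * D * Q) (hSu : IsUnit S) {α : ℝ} (hα : α ≠ 0) :
    leftPrecond α D Q R *
      fromBlocks (α⁻¹ • (D - D * Q * S⁻¹ * Qᵀ * D)) (D * Q * S⁻¹ * (R⁻¹)ᵀ)
        (R⁻¹ * S⁻¹ * Qᵀ * D) (-(α • (R⁻¹ * S⁻¹ * (R⁻¹)ᵀ))) = 1 := by
  have hRi := Matrix.mul_nonsing_inv _ ((Matrix.isUnit_iff_isUnit_det _).mp hR)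
  have hSi := Matrix.mul_nonsing_inv _ ((Matrix.isUnit_iff_isUnit_det _).mp hSu)
  have hRt : Rᵀ * (R⁻¹)ᵀ = 1 := by
    rw [← Matrix.transpose_mul, Matrix.nonsing_inv_mul _ ((Matrix.isUnit_iff_isUnit_det _).mp hR),
      Matrix.transpose_one]
  -- Cancellation of `S S⁻¹` for right-associated products; it occurs with `m` columns in the first
  -- block column and with `n` in the second.
  have hSS (X : Matrix (Fin n) (Fin m) ℝ) : Qᵀ * (D * (Q * (S⁻¹ * X))) = X := by
    rw [← Matrix.mul_assoc D, ← Matrix.mul_assoc Qᵀ, ← Matrix.mul_assoc Qᵀ, ← hS,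
      ← Matrix.mul_assoc, hSi, Matrix.one_mul]
  have hSS' (X : Matrix (Fin n) (Fin n) ℝ) : Qᵀ * (D * (Q * (S⁻¹ * X))) = X := by
    rw [← Matrix.mul_assoc D, ← Matrix.mul_assoc Qᵀ, ← Matrix.mul_assoc Qᵀ, ← hS,
      ← Matrix.mul_assoc, hSi, Matrix.one_mul]
  have hRR {k : ℕ} (X : Matrix (Fin n) (Fin k) ℝ) : R * (R⁻¹ * X) = X := by
    rw [← Matrix.mul_assoc, hRi, Matrix.one_mul]
  have hDD {k : ℕ} (X : Matrix (Fin m) (Fin k) ℝ) : D⁻¹ * (D * X) = X := by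
    rw [← Matrix.mul_assoc, hD, Matrix.one_mul]
  rw [leftPrecond, Matrix.fromBlocks_multiply, ← Matrix.fromBlocks_one]
  simp only [Matrix.mul_assoc, Matrix.smul_mul, Matrix.mul_smul, Matrix.mul_sub, Matrix.mul_neg,
    smul_sub, inv_mul_cancel₀ hα, neg_zero,
    Matrix.zero_mul, hSS, hSS', hRR, hDD, hD, hRt, smul_smul, one_smul, add_zero,
    sub_self, smul_zero, sub_add_cancel, add_neg_cancel]

/-- The blocks `αD⁻¹` cancel in `Ẽ`, leaving only `-E` and `-Eᵀ` off the diagonal. The product is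
then formal and needs no invertibility. -/
theorem leftPrecond_inv_mul_augError {D : Matrix (Fin m) (Fin m) ℝ}
    {A Q : Matrix (Fin m) (Fin n) ℝ} {R S : Matrix (Fin n) (Fin n) ℝ} {α : ℝ} :
    fromBlocks (α⁻¹ • (D - D * Q * S⁻¹ * Qᵀ * D)) (D * Q * S⁻¹ * (R⁻¹)ᵀ)
        (R⁻¹ * S⁻¹ * Qᵀ * D) (-(α • (R⁻¹ * S⁻¹ * (R⁻¹)ᵀ))) * augError α D A Q R =
      fromBlocks (-(D * Q * S⁻¹ * (R⁻¹)ᵀ * (qrError A Q R)ᵀ))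
        (-(α⁻¹ • ((D - D * Q * S⁻¹ * Qᵀ * D) * qrError A Q R)))
        (α • (R⁻¹ * S⁻¹ * (R⁻¹)ᵀ * (qrError A Q R)ᵀ)) (-(R⁻¹ * S⁻¹ * Qᵀ * D * qrError A Q R)) := by
  have h : augError α D A Q R = fromBlocks 0 (-qrError A Q R) (-(qrError A Q R)ᵀ) 0 := by
    rw [augError, augMatrix, leftPrecond, sub_eq_add_neg, Matrix.fromBlocks_neg,
      Matrix.fromBlocks_add, qrError]
    simp [sub_eq_add_neg]
  rw [h, Matrix.fromBlocks_multiply]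
  simp

theorem preconditioner_formulas {d : Fin m → ℝ} (hd : ∀ i, 0 < d i)
    {A Q : Matrix (Fin m) (Fin n) ℝ} (hQ : Qᵀ * Q = 1) {R : Matrix (Fin n) (Fin n) ℝ}
    (hR : IsUnit R) {α : ℝ} (hα : α ≠ 0) {D : Matrix (Fin m) (Fin m) ℝ}
    {S : Matrix (Fin n) (Fin n) ℝ} {E : Matrix (Fin m) (Fin n) ℝ}
    (hD : D = diagonal d) (hS : S = Qᵀ * D * Q) (hE : E = qrError A Q R) :
    IsUnit S ∧ IsUnit (leftPrecond α D Q R) ∧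
      (leftPrecond α D Q R)⁻¹ =
        fromBlocks (α⁻¹ • (D - D * Q * S⁻¹ * Qᵀ * D)) (D * Q * S⁻¹ * (R⁻¹)ᵀ)
          (R⁻¹ * S⁻¹ * Qᵀ * D) (-(α • (R⁻¹ * S⁻¹ * (R⁻¹)ᵀ))) ∧
      (leftPrecond α D Q R)⁻¹ * augError α D A Q R =
        fromBlocks (-(D * Q * S⁻¹ * (R⁻¹)ᵀ * Eᵀ))
          (-(α⁻¹ • ((D - D * Q * S⁻¹ * Qᵀ * D) * E)))
          (α • (R⁻¹ * S⁻¹ * (R⁻¹)ᵀ * Eᵀ)) (-(R⁻¹ * S⁻¹ * Qᵀ * D * E)) := by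
  have hSu : IsUnit S := by
    rw [hS, hD]
    exact isUnit_weighted_gram hd hQ
  have h := leftPrecond_mul_eq_one (by rw [hD]; exact diagonal_inv_mul_cancel hd) hR hS hSu hα
  have hinv := Matrix.inv_eq_right_inv h
  refine ⟨hSu, IsUnit.of_mul_eq_one _ h, hinv, ?_⟩
  rw [hinv, hE]
  exact leftPrecond_inv_mul_augError

end Preconditioner

/-! ### Estimates of `R⁻¹` and of `M_l⁻¹Ẽ` -/

section Estimates

variable {m n : ℕ}

/-- Full column rank makes `A` injective, so it cancels on the left in `A A† A = A`. -/
theorem pinv_mul_self {A : Matrix (Fin m) (Fin n) ℝ} (hA : A.rank = n) : pinv A * A = 1 := by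
  have hk : LinearMap.ker A.mulVecLin = ⊥ := by
    have h1 := LinearMap.finrank_range_add_finrank_ker A.mulVecLin
    have h2 : Module.finrank ℝ (LinearMap.range A.mulVecLin) = n := hA
    rw [h2, Module.finrank_fin_fun] at h1
    exact Submodule.finrank_eq_zero.mp (by omega)
  have h : A * (pinv A * A) = A * (1 : Matrix (Fin n) (Fin n) ℝ) := by
    rw [← Matrix.mul_assoc, (pinv_penrose A hA).1, Matrix.mul_one]
  refine Matrix.toLin'.injective (LinearMap.ext fun v => LinearMap.ker_eq_bot.mp hk ?_)
  simpa [Matrix.mulVec_mulVec] using congrArg (fun M => M *ᵥ v) h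

theorem one_le_condInfRect (hn : 0 < n) {A : Matrix (Fin m) (Fin n) ℝ} (hA : A.rank = n) :
    1 ≤ condInfRect A := by
  have : Nonempty (Fin n) := ⟨⟨0, hn⟩⟩
  rw [condInfRect, mul_comm, ← infNorm_one (ι := Fin n), ← pinv_mul_self hA]
  exact infNorm_mul_le _ _

theorem one_le_thetaWeight (D : Matrix (Fin m) (Fin m) ℝ) : 1 ≤ thetaWeight D :=
  le_max_left _ _

theorem specNorm_le_thetaWeight (D : Matrix (Fin m) (Fin m) ℝ) : specNorm D ≤ thetaWeight D :=
  (le_max_left _ _).trans (le_max_right _ _)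

theorem specNorm_inv_le_thetaWeight (D : Matrix (Fin m) (Fin m) ℝ) :
    specNorm D⁻¹ ≤ thetaWeight D :=
  (le_max_right _ _).trans (le_max_right _ _)

theorem specNorm_pinv_mul_frobNorm_le (A : Matrix (Fin m) (Fin n) ℝ) :
    specNorm (pinv A) * frobNorm A ≤ Real.sqrt m * Real.sqrt n * condInfRect A := by
  have h1 := specNorm_le_sqrt_card_mul_infNorm (pinv A)
  have h2 := frobNorm_le_sqrt_card_mul_infNorm A
  rw [Fintype.card_fin] at h1 h2
  calc specNorm (pinv A) * frobNorm A
      ≤ (Real.sqrt n * infNorm (pinv A)) * (Real.sqrt m * infNorm A) :=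
        mul_le_mul h1 h2 (frobNorm_nonneg _) ((specNorm_nonneg _).trans h1)
    _ = Real.sqrt m * Real.sqrt n * condInfRect A := by rw [condInfRect]; ring

/-- `R⁻¹ = (1 + A†E)⁻¹ A† Q`, since `A† Q R = 1 + A† E`. -/
theorem isUnit_and_specNorm_inv_le (hn : 0 < n) {A Q : Matrix (Fin m) (Fin n) ℝ}
    {R : Matrix (Fin n) (Fin n) ℝ} (hA : A.rank = n) (hQ : Qᵀ * Q = 1)
    (hx : specNorm (pinv A) * frobNorm (qrError A Q R) < 1) :
    IsUnit R ∧ specNorm R⁻¹ ≤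
      specNorm (pinv A) * (1 - specNorm (pinv A) * frobNorm (qrError A Q R))⁻¹ := by
  have : Nonempty (Fin n) := ⟨⟨0, hn⟩⟩
  set F := pinv A * qrError A Q R with hF
  have hFx : specNorm F ≤ specNorm (pinv A) * frobNorm (qrError A Q R) :=
    (specNorm_mul_le _ _).trans
      (mul_le_mul_of_nonneg_left (specNorm_le_frobNorm _) (specNorm_nonneg _))
  have hF1 : specNorm F < 1 := hFx.trans_lt hx
  have hFu := (Matrix.isUnit_iff_isUnit_det _).mp (isUnit_one_add_of_specNorm_lt_one hF1)
  have hR : pinv A * Q * R = 1 + F := by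
    rw [hF, qrError, Matrix.mul_sub, pinv_mul_self hA, Matrix.mul_assoc]
    abel
  have hl : (1 + F)⁻¹ * (pinv A * Q) * R = 1 := by
    rw [Matrix.mul_assoc, hR, Matrix.nonsing_inv_mul _ hFu]
  refine ⟨IsUnit.of_mul_eq_one_right _ hl, ?_⟩
  rw [Matrix.inv_eq_left_inv hl]
  have h1 : specNorm (pinv A * Q) ≤ specNorm (pinv A) := (specNorm_mul_le _ _).trans
    (mul_le_of_le_one_right (specNorm_nonneg _) (specNorm_le_one_of_orthonormal hQ))
  have h2 : specNorm (1 + F)⁻¹ ≤ (1 - specNorm (pinv A) * frobNorm (qrError A Q R))⁻¹ :=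
    (specNorm_inv_one_add_le hF1).trans (inv_anti₀ (by linarith) (by linarith))
  rw [mul_comm (specNorm (pinv A))]
  exact (specNorm_mul_le _ _).trans
    (mul_le_mul h2 h1 (specNorm_nonneg _) ((specNorm_nonneg _).trans h2))

theorem specNorm_mul_le_of_le {ι κ μ : Type*} [Fintype ι] [Fintype κ] [Fintype μ] [DecidableEq κ]
    [DecidableEq μ] {X : Matrix ι κ ℝ} {Y : Matrix κ μ ℝ} {a b : ℝ} (hX : specNorm X ≤ a)
    (hY : specNorm Y ≤ b) : specNorm (X * Y) ≤ a * b :=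
  (specNorm_mul_le X Y).trans (mul_le_mul hX hY (specNorm_nonneg _) ((specNorm_nonneg _).trans hX))

/-- Separates the weights from the scalars. The diagonal blocks use `h₁` with weight `ρ`, the upper
right block `h₂` with `θ`, and the lower left block `h₃` with `θ`. -/
theorem infNorm_leftPrecond_inv_mul_augError_le_blocks (hn : 0 < n) {d : Fin m → ℝ}
    (hd : ∀ i, 0 < d i) {A Q : Matrix (Fin m) (Fin n) ℝ} (hQ : Qᵀ * Q = 1) {R : Matrix (Fin n) (Fin n) ℝ}
    (hR : IsUnit R) {α t : ℝ} (hα : α ≠ 0)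
    (h₁ : specNorm R⁻¹ * frobNorm (qrError A Q R) ≤ t)
    (h₂ : |α|⁻¹ * frobNorm (qrError A Q R) ≤ t)
    (h₃ : |α| * specNorm R⁻¹ ^ 2 * frobNorm (qrError A Q R) ≤ t) :
    infNorm ((leftPrecond α (diagonal d) Q R)⁻¹ * augError α (diagonal d) A Q R) ≤
      (Real.sqrt m + Real.sqrt n) * (rhoWeight (diagonal d) Q * thetaWeight (diagonal d)) * t := by
  set E := qrError A Q R with hE
  set D := diagonal d with hD
  set S := Qᵀ * D * Q with hS
  rw [(preconditioner_formulas (A := A) hd hQ hR hα hD hS hE).2.2.2]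
  set ρ := rhoWeight D Q with hρ
  set θ := thetaWeight D
  have hρ1 : 1 ≤ ρ := one_le_rhoWeight hn hd hQ
  have hθ1 : 1 ≤ θ := one_le_thetaWeight D
  have hρθ : ρ ≤ ρ * θ := le_mul_of_one_le_right (by linarith) hθ1
  have hθρ : θ ≤ ρ * θ := le_mul_of_one_le_left (by linarith) hρ1
  have hEs : specNorm E ≤ frobNorm E := specNorm_le_frobNorm E
  have hEt : specNorm Eᵀ ≤ frobNorm E := (specNorm_transpose E).le.trans hEs
  have hRt : specNorm (R⁻¹)ᵀ ≤ specNorm R⁻¹ := (specNorm_transpose _).le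
  have hSn : specNorm S⁻¹ ≤ θ :=
    (specNorm_inv_weighted_gram_le hd hQ).trans (specNorm_inv_le_thetaWeight D)
  have hDn : specNorm (D - D * Q * S⁻¹ * Qᵀ * D) ≤ θ :=
    (specNorm_weighted_complement_le hd hQ).trans (specNorm_le_thetaWeight D)
  have hX : specNorm (S⁻¹ * Qᵀ * D) ≤ ρ := le_rfl
  have hXt : specNorm (D * Q * S⁻¹) ≤ ρ := by
    have h : D * Q * S⁻¹ = (S⁻¹ * Qᵀ * D)ᵀ := by
      simp [hS, hD, Matrix.transpose_mul, Matrix.transpose_nonsing_inv, Matrix.mul_assoc]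
    rw [h, specNorm_transpose]
    exact hX
  have ht : 0 ≤ t := (mul_nonneg (specNorm_nonneg _) (frobNorm_nonneg _)).trans h₁
  have hb {ι : Type} [Fintype ι] {k : ℕ} {X : Matrix ι (Fin k) ℝ} {s : ℝ} (hs : s ≤ ρ * θ)
      (hX : specNorm X ≤ s * t) : infNorm X ≤ Real.sqrt k * (ρ * θ * t) := by
    have h := infNorm_le_sqrt_card_mul_specNorm X
    rw [Fintype.card_fin] at h
    exact h.trans (mul_le_mul_of_nonneg_left
      (hX.trans (mul_le_mul_of_nonneg_right hs ht)) (Real.sqrt_nonneg _))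
  have h11 : infNorm (-(D * Q * S⁻¹ * (R⁻¹)ᵀ * Eᵀ)) ≤ Real.sqrt m * (ρ * θ * t) := by
    rw [infNorm_neg]
    refine hb hρθ ((specNorm_mul_le_of_le (specNorm_mul_le_of_le hXt hRt) hEt).trans ?_)
    rw [mul_assoc]
    exact mul_le_mul_of_nonneg_left h₁ (by linarith)
  have h12 : infNorm (-(α⁻¹ • ((D - D * Q * S⁻¹ * Qᵀ * D) * E))) ≤
      Real.sqrt n * (ρ * θ * t) := by
    rw [infNorm_neg]
    refine hb hθρ ?_
    rw [specNorm_smul, abs_inv]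
    calc |α|⁻¹ * specNorm ((D - D * Q * S⁻¹ * Qᵀ * D) * E) ≤ |α|⁻¹ * (θ * frobNorm E) :=
          mul_le_mul_of_nonneg_left (specNorm_mul_le_of_le hDn hEs) (by positivity)
      _ = θ * (|α|⁻¹ * frobNorm E) := by ring
      _ ≤ θ * t := mul_le_mul_of_nonneg_left h₂ (by linarith)
  have h21 : infNorm (α • (R⁻¹ * S⁻¹ * (R⁻¹)ᵀ * Eᵀ)) ≤ Real.sqrt m * (ρ * θ * t) := by
    refine hb hθρ ?_
    rw [specNorm_smul]
    calc |α| * specNorm (R⁻¹ * S⁻¹ * (R⁻¹)ᵀ * Eᵀ)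
        ≤ |α| * (specNorm R⁻¹ * θ * specNorm R⁻¹ * frobNorm E) :=
          mul_le_mul_of_nonneg_left (specNorm_mul_le_of_le (specNorm_mul_le_of_le
            (specNorm_mul_le_of_le le_rfl hSn) hRt) hEt) (abs_nonneg α)
      _ = θ * (|α| * specNorm R⁻¹ ^ 2 * frobNorm E) := by ring
      _ ≤ θ * t := mul_le_mul_of_nonneg_left h₃ (by linarith)
  have h22 : infNorm (-(R⁻¹ * S⁻¹ * Qᵀ * D * E)) ≤ Real.sqrt n * (ρ * θ * t) := by
    rw [infNorm_neg]
    refine hb hρθ ?_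
    have h : R⁻¹ * S⁻¹ * Qᵀ * D * E = R⁻¹ * (S⁻¹ * Qᵀ * D) * E := by
      simp only [Matrix.mul_assoc]
    rw [h]
    refine (specNorm_mul_le_of_le (specNorm_mul_le_of_le le_rfl hX) hEs).trans ?_
    rw [mul_comm (specNorm R⁻¹), mul_assoc]
    exact mul_le_mul_of_nonneg_left h₁ (by linarith)
  refine infNorm_fromBlocks_le _ _ _ _ ?_ ?_ <;> linarith

/-- The three scalars are at most `x` times `1/(1 - x)`, `1/(1 - τ)` and `(1 + τ)/(1 - x)²`. For `x,
τ ≤ 1/2` the factor `1 + 8x + 8τ` dominates all three; the constant 8 is not sharp. -/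
theorem infNorm_leftPrecond_inv_mul_augError_le (hn : 0 < n) {d : Fin m → ℝ} (hd : ∀ i, 0 < d i)
    {A Q : Matrix (Fin m) (Fin n) ℝ} {R : Matrix (Fin n) (Fin n) ℝ} (hA : A.rank = n)
    (hQ : Qᵀ * Q = 1) {α τ x : ℝ} (hτ : τ ≤ 1 / 2) (hα : |(|α| * specNorm (pinv A)) - 1| ≤ τ)
    (hx : x = specNorm (pinv A) * frobNorm (qrError A Q R)) (hx2 : x ≤ 1 / 2) :
    α ≠ 0 ∧ IsUnit R ∧
      infNorm ((leftPrecond α (diagonal d) Q R)⁻¹ * augError α (diagonal d) A Q R) ≤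
        (Real.sqrt m + Real.sqrt n) * (rhoWeight (diagonal d) Q * thetaWeight (diagonal d)) *
          (x * (1 + 8 * x + 8 * τ)) := by
  obtain ⟨hR, hr⟩ := isUnit_and_specNorm_inv_le (R := R) hn hA hQ (by linarith)
  rw [← hx] at hr
  have he := frobNorm_nonneg (qrError A Q R)
  have hr0 := specNorm_nonneg R⁻¹
  have hp := specNorm_nonneg (pinv A)
  obtain ⟨hα1, hα2⟩ := abs_le.mp hα
  have hα0 : α ≠ 0 := by
    rintro rfl
    rw [abs_zero, zero_mul] at hα1
    linarith
  refine ⟨hα0, hR, infNorm_leftPrecond_inv_mul_augError_le_blocks hn hd hQ hR hα0 ?_ ?_ ?_⟩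
  all_goals
    set e := frobNorm (qrError A Q R)
    set p := specNorm (pinv A)
    set r := specNorm R⁻¹
    have hx0 : 0 ≤ x := hx ▸ mul_nonneg hp he
    have hτ0 : 0 ≤ τ := (abs_nonneg _).trans hα
    have hr' : r * (1 - x) ≤ p := by
      rw [← div_eq_mul_inv, le_div_iff₀ (by linarith)] at hr
      exact hr
    have ha : 0 < |α| := abs_pos.mpr hα0
  · have h1 : r * e * (1 - x) ≤ x := by nlinarith
    have h2 : r * e ≤ x / (1 - x) := (le_div_iff₀ (by linarith)).mpr h1
    refine h2.trans ((div_le_iff₀ (by linarith)).mpr ?_)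
    have h3 : 1 ≤ (1 + 8 * x + 8 * τ) * (1 - x) := by nlinarith
    rw [mul_assoc]
    exact le_mul_of_one_le_right hx0 h3
  · rw [inv_mul_le_iff₀ ha]
    -- This is `1 - τ ≤ |α|‖A†‖₂` multiplied by `e`.
    have h1 : (1 - τ) * e ≤ |α| * x := by rw [hx]; nlinarith
    have h3 : 1 ≤ (1 + 8 * x + 8 * τ) * (1 - τ) := by nlinarith
    have h4 : e ≤ (1 + 8 * x + 8 * τ) * ((1 - τ) * e) := by
      rw [← mul_assoc]
      exact le_mul_of_one_le_left he h3
    have h5 := mul_le_mul_of_nonneg_left h1 (by linarith : 0 ≤ 1 + 8 * x + 8 * τ)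
    linarith
  · have h1 : (r * (1 - x)) ^ 2 ≤ p ^ 2 :=
      pow_le_pow_left₀ (mul_nonneg hr0 (by linarith)) hr' 2
    have h2 : |α| * r ^ 2 * e * (1 - x) ^ 2 ≤ (1 + τ) * x := by
      calc |α| * r ^ 2 * e * (1 - x) ^ 2 = |α| * e * (r * (1 - x)) ^ 2 := by ring
        _ ≤ |α| * e * p ^ 2 := mul_le_mul_of_nonneg_left h1 (mul_nonneg ha.le he)
        _ = |α| * p * x := by rw [hx]; ring
        _ ≤ (1 + τ) * x := mul_le_mul_of_nonneg_right (by linarith) hx0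
    have h3 : |α| * r ^ 2 * e ≤ (1 + τ) * x / (1 - x) ^ 2 :=
      (le_div_iff₀ (pow_pos (by linarith) 2)).mpr h2
    refine h3.trans ((div_le_iff₀ (pow_pos (by linarith) 2)).mpr ?_)
    have h4 : 1 ≤ (1 + 6 * x) * (1 - x) ^ 2 := by
      have h : (1 + 6 * x) * (1 - x) ^ 2 = 1 + x * ((1 - 2 * x) * (4 - 3 * x)) := by ring
      rw [h]
      have : 0 ≤ x * ((1 - 2 * x) * (4 - 3 * x)) :=
        mul_nonneg hx0 (mul_nonneg (by linarith) (by linarith))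
      linarith
    have h5 : (1 + τ) * (1 + 6 * x) ≤ 1 + 8 * x + 8 * τ := by nlinarith
    calc (1 + τ) * x ≤ (1 + τ) * x * ((1 + 6 * x) * (1 - x) ^ 2) :=
          le_mul_of_one_le_right (mul_nonneg (by linarith) hx0) h4
      _ = x * (((1 + τ) * (1 + 6 * x)) * (1 - x) ^ 2) := by ring
      _ ≤ x * ((1 + 8 * x + 8 * τ) * (1 - x) ^ 2) := by gcongr
      _ = x * (1 + 8 * x + 8 * τ) * (1 - x) ^ 2 := by ring

end Estimates

/-! ### Uniform constants and the final bounds -/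

theorem first_order_bounds {m n : ℕ} (hn : 0 < n) (hmn : n ≤ m) {c K : ℝ} (hc : 0 < c)
    (hK : 0 ≤ K) : ∃ δ > (0 : ℝ), ∃ C > (0 : ℝ),
      ∀ (d : Fin m → ℝ) (A Q : Matrix (Fin m) (Fin n) ℝ) (R : Matrix (Fin n) (Fin n) ℝ)
        (α u : ℝ), (∀ i, 0 < d i) → A.rank = n → 0 < u → IsComputedQR c u A Q R →
        |(|α| * specNorm (pinv A)) - 1| ≤ K * u →
        ∀ (D : Matrix (Fin m) (Fin m) ℝ) (ρ θ : ℝ),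
          D = diagonal d → ρ = rhoWeight D Q → θ = thetaWeight D →
          ρ * θ * condInfRect A * u ≤ δ →
          α ≠ 0 ∧ IsUnit R ∧ IsUnit (leftPrecond α D Q R) ∧ IsUnit (augMatrix α D A) ∧
          infNorm ((leftPrecond α D Q R)⁻¹ * augError α D A Q R) ≤
            (Real.sqrt m + Real.sqrt n) * ρ * θ * specNorm (pinv A) * frobNorm (qrError A Q R)
              + C * (ρ * θ * condInfRect A * u) ^ 2 ∧
          infNorm ((leftPrecond α D Q R)⁻¹ * augError α D A Q R) ≤
            2 * m * Real.sqrt n * ρ * θ * gammaTilde c m n u * condInfRect A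
              + C * (ρ * θ * condInfRect A * u) ^ 2 ∧
          condInf ((leftPrecond α D Q R)⁻¹ * augMatrix α D A) ≤
            (1 + 2 * m * Real.sqrt n * ρ * θ * gammaTilde c m n u * condInfRect A) ^ 2
              + C * (ρ * θ * condInfRect A * u) ^ 2 := by
  have hn' : (1 : ℝ) ≤ n := by exact_mod_cast hn
  have hm' : (1 : ℝ) ≤ m := by exact_mod_cast hn.trans_le hmn
  have hsm : Real.sqrt m ^ 2 = m := Real.sq_sqrt (Nat.cast_nonneg m)
  have hsn : Real.sqrt n ^ 2 = n := Real.sq_sqrt (Nat.cast_nonneg n)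
  have hsm1 : 1 ≤ Real.sqrt m := Real.one_le_sqrt.mpr hm'
  have hsn1 : 1 ≤ Real.sqrt n := Real.one_le_sqrt.mpr hn'
  have hsnm : Real.sqrt n ≤ Real.sqrt m := Real.sqrt_le_sqrt (by exact_mod_cast hmn)
  obtain ⟨N, hN⟩ : ∃ N : ℝ, N = m * n := ⟨_, rfl⟩
  have hN1 : 1 ≤ N := hN ▸ one_le_mul_of_one_le_of_one_le hm' hn'
  -- Once `N u ≤ 1/2`, `γ̃ ≤ 2cNu`; thus `x ≤ c' κ u`.
  obtain ⟨c', hc'⟩ : ∃ c' : ℝ, c' = Real.sqrt m * Real.sqrt n * (2 * c * N) := ⟨_, rfl⟩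
  have hc'0 : 0 < c' := by rw [hc']; positivity
  obtain ⟨b, hb⟩ : ∃ b : ℝ, b = Real.sqrt m + Real.sqrt n := ⟨_, rfl⟩
  have hb0 : 0 < b := by rw [hb]; positivity
  -- `B₁ η²` will bound the second-order part of `‖G‖∞`, and `B₂ η` the first-order part `β`.
  obtain ⟨B₁, hB₁⟩ : ∃ B₁ : ℝ, B₁ = b * c' * (8 * c' + 8 * K) := ⟨_, rfl⟩
  have hB₁0 : 0 < B₁ := by rw [hB₁]; positivity
  obtain ⟨B₂, hB₂⟩ : ∃ B₂ : ℝ, B₂ = 2 * m * Real.sqrt n * (2 * c * N) := ⟨_, rfl⟩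
  have hB₂0 : 0 < B₂ := by rw [hB₂]; positivity
  -- With `η ≤ 1/T`, each of `N u`, `K u`, `x` and `‖G‖∞` is at most `1/2`.
  obtain ⟨T, hT⟩ : ∃ T : ℝ, T = 2 * (N + K + c' + (B₁ + B₂)) := ⟨_, rfl⟩
  have hT0 : 0 < T := by rw [hT]; positivity
  refine ⟨T⁻¹, inv_pos.mpr hT0, 2 * B₁ + 4 * (B₁ + B₂) ^ 2, by positivity, ?_⟩
  rintro d A Q R α u hd hA hu ⟨hQ, -, hE⟩ hα D ρ θ rfl hρ hθ hη
  have hρ1 : 1 ≤ ρ := hρ ▸ one_le_rhoWeight hn hd hQ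
  have hθ1 : 1 ≤ θ := hθ ▸ one_le_thetaWeight _
  have hκ1 : 1 ≤ condInfRect A := one_le_condInfRect hn hA
  obtain ⟨x, hx⟩ : ∃ x, x = specNorm (pinv A) * frobNorm (qrError A Q R) := ⟨_, rfl⟩
  obtain ⟨γ, hγ⟩ : ∃ γ, γ = gammaTilde c m n u := ⟨_, rfl⟩
  have hx0 : 0 ≤ x := hx ▸ mul_nonneg (specNorm_nonneg _) (frobNorm_nonneg _)
  have hpA := specNorm_pinv_mul_frobNorm_le A
  obtain ⟨κ, hκ⟩ : ∃ κ, κ = condInfRect A := ⟨_, rfl⟩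
  obtain ⟨η, hηd⟩ : ∃ η, η = ρ * θ * κ * u := ⟨_, rfl⟩
  rw [← hκ] at hκ1 hη hpA ⊢
  rw [← hηd] at hη ⊢
  rw [← hγ] at hE ⊢
  have hq1 : 1 ≤ ρ * θ := one_le_mul_of_one_le_of_one_le hρ1 hθ1
  have hκu : κ * u ≤ η := by
    rw [hηd, mul_assoc (ρ * θ)]
    exact le_mul_of_one_le_left (by positivity) hq1
  have huη : u ≤ η := (le_mul_of_one_le_left hu.le hκ1).trans hκu
  have hη0 : 0 < η := hu.trans_le huη
  have hηT : η * (2 * (N + K + c' + (B₁ + B₂))) ≤ 1 := by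
    rw [← hT]
    exact (le_div_iff₀ hT0).mp (by rwa [one_div])
  have hηy (y : ℝ) (hy : 2 * y ≤ 2 * (N + K + c' + (B₁ + B₂))) : η * y ≤ 1 / 2 := by
    have := mul_le_mul_of_nonneg_left hy hη0.le
    linarith
  have hηN : η * N ≤ 1 / 2 := hηy N (by linarith)
  have hηK : η * K ≤ 1 / 2 := hηy K (by linarith)
  have hηc : η * c' ≤ 1 / 2 := hηy c' (by linarith)
  have hηB : η * (B₁ + B₂) ≤ 1 / 2 := hηy (B₁ + B₂) (by linarith)
  have hη1 : η ≤ 1 := by linarith [le_mul_of_one_le_right hη0.le hN1]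
  have hNu : N * u ≤ 1 / 2 := by
    linarith [mul_le_mul_of_nonneg_left huη (zero_le_one.trans hN1)]
  have hKu : K * u ≤ 1 / 2 := by linarith [mul_le_mul_of_nonneg_left huη hK]
  have hγ0 : 0 ≤ γ := by
    rw [hγ, gammaTilde, ← hN]
    exact div_nonneg (by positivity) (by linarith)
  have hγu : γ ≤ 2 * c * N * u := by
    rw [hγ, gammaTilde, ← hN, mul_assoc c, ← hN, div_le_iff₀ (by linarith)]
    have h : 0 ≤ c * N * u * (1 - 2 * (N * u)) := mul_nonneg (by positivity) (by linarith)
    linarith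
  have hxγ : x ≤ Real.sqrt m * Real.sqrt n * κ * γ := by
    calc x ≤ specNorm (pinv A) * (γ * frobNorm A) :=
          hx ▸ mul_le_mul_of_nonneg_left hE (specNorm_nonneg _)
      _ = specNorm (pinv A) * frobNorm A * γ := by ring
      _ ≤ Real.sqrt m * Real.sqrt n * κ * γ := mul_le_mul_of_nonneg_right hpA hγ0
  have hxκ : x ≤ c' * (κ * u) := by
    calc x ≤ Real.sqrt m * Real.sqrt n * κ * γ := hxγ
      _ ≤ Real.sqrt m * Real.sqrt n * κ * (2 * c * N * u) := by gcongr
      _ = c' * (κ * u) := by rw [hc']; ring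
  have hx2 : x ≤ 1 / 2 := by linarith [mul_le_mul_of_nonneg_left hκu hc'0.le]
  obtain ⟨hα0, hR, hG⟩ :=
    infNorm_leftPrecond_inv_mul_augError_le hn hd hA hQ hKu hα hx hx2
  rw [← hρ, ← hθ, ← hb] at hG
  obtain ⟨-, hM, -, -⟩ := preconditioner_formulas (A := A) hd hQ hR hα0 rfl rfl rfl
  have hMd := (Matrix.isUnit_iff_isUnit_det _).mp hM
  obtain ⟨G, hGd⟩ : ∃ G, G =
    (leftPrecond α (diagonal d) Q R)⁻¹ * augError α (diagonal d) A Q R := ⟨_, rfl⟩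
  have hG1 : (leftPrecond α (diagonal d) Q R)⁻¹ * augMatrix α (diagonal d) A = 1 + G := by
    rw [hGd, augError, Matrix.mul_sub, Matrix.nonsing_inv_mul _ hMd]
    abel
  rw [← hGd] at hG ⊢
  rw [hG1]
  have hfirst : infNorm G ≤ b * (ρ * θ) * x + B₁ * η ^ 2 := by
    have h1 : x * (8 * x + 8 * (K * u)) ≤ c' * (8 * c' + 8 * K) * (κ * u) ^ 2 := by
      calc x * (8 * x + 8 * (K * u))
          ≤ c' * (κ * u) * (8 * (c' * (κ * u)) + 8 * (K * (κ * u))) := by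
            gcongr
            exact le_mul_of_one_le_left hu.le hκ1
        _ = c' * (8 * c' + 8 * K) * (κ * u) ^ 2 := by ring
    -- A single factor `ρθ` suffices: it turns one `κu` into `η`, and the other satisfies `κu ≤ η`
    -- because `ρθ ≥ 1`.
    have h2 : ρ * θ * (κ * u) ^ 2 ≤ η ^ 2 := by
      calc ρ * θ * (κ * u) ^ 2 = η * (κ * u) := by rw [hηd]; ring
        _ ≤ η * η := by gcongr
        _ = η ^ 2 := by ring
    calc infNorm G ≤ b * (ρ * θ) * (x * (1 + 8 * x + 8 * (K * u))) := hG
      _ = b * (ρ * θ) * x + b * (ρ * θ) * (x * (8 * x + 8 * (K * u))) := by ring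
      _ ≤ b * (ρ * θ) * x + b * (ρ * θ) * (c' * (8 * c' + 8 * K) * (κ * u) ^ 2) := by gcongr
      _ = b * (ρ * θ) * x + B₁ * (ρ * θ * (κ * u) ^ 2) := by rw [hB₁]; ring
      _ ≤ b * (ρ * θ) * x + B₁ * η ^ 2 := by gcongr
  obtain ⟨β, hβ⟩ : ∃ β, β = 2 * m * Real.sqrt n * ρ * θ * γ * κ := ⟨_, rfl⟩
  have hβ0 : 0 ≤ β := by rw [hβ]; positivity
  have hβη : β ≤ B₂ * η := by
    calc β ≤ 2 * m * Real.sqrt n * ρ * θ * (2 * c * N * u) * κ := by rw [hβ]; gcongr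
      _ = B₂ * η := by rw [hB₂, hηd]; ring
  have hbβ : b * (ρ * θ) * x ≤ β := by
    have h1 : b * (Real.sqrt m * Real.sqrt n) ≤ 2 * m * Real.sqrt n := by
      -- Here `n ≤ m` enters: `(√m + √n)√m ≤ 2m`.
      have h : b * Real.sqrt m ≤ 2 * m := by
        rw [hb]
        linarith [mul_le_mul_of_nonneg_right hsnm (zero_le_one.trans hsm1)]
      rw [← mul_assoc]
      exact mul_le_mul_of_nonneg_right h (zero_le_one.trans hsn1)
    calc b * (ρ * θ) * x ≤ b * (ρ * θ) * (Real.sqrt m * Real.sqrt n * κ * γ) := by gcongr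
      _ = b * (Real.sqrt m * Real.sqrt n) * (ρ * θ * κ * γ) := by ring
      _ ≤ 2 * m * Real.sqrt n * (ρ * θ * κ * γ) := by gcongr
      _ = β := by rw [hβ]; ring
  have hsecond : infNorm G ≤ β + B₁ * η ^ 2 := by linarith
  have hGη : infNorm G ≤ (B₁ + B₂) * η := by
    have : B₁ * η ^ 2 ≤ B₁ * η := by
      rw [sq]
      exact mul_le_mul_of_nonneg_left (mul_le_of_le_one_left hη0.le hη1) hB₁0.le
    linarith
  have hG2 : infNorm G ≤ 1 / 2 := by linarith
  have hGu : IsUnit (1 + G) := isUnit_one_add_of_infNorm_lt_one (by linarith)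
  have hC : B₁ * η ^ 2 ≤ (2 * B₁ + 4 * (B₁ + B₂) ^ 2) * η ^ 2 := by
    gcongr
    linarith [sq_nonneg (B₁ + B₂)]
  rw [← hβ]
  refine ⟨hα0, hR, hM, ?_, ?_, by linarith, ?_⟩
  · have h : augMatrix α (diagonal d) A = leftPrecond α (diagonal d) Q R * (1 + G) := by
      rw [← hG1, ← Matrix.mul_assoc, Matrix.mul_nonsing_inv _ hMd, Matrix.one_mul]
    rw [h]
    exact hM.mul hGu
  · have h : (Real.sqrt m + Real.sqrt n) * ρ * θ * specNorm (pinv A) * frobNorm (qrError A Q R) =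
        b * (ρ * θ) * x := by rw [hb, hx]; ring
    linarith
  -- Insert `‖G‖ ≤ β + B₁η²` in the linear term and `‖G‖ ≤ (B₁ + B₂)η` in the quadratic one; `1 + 2β
  -- ≤ (1 + β)²` leaves exactly the chosen `C η²`.
  · have h1 := condInf_one_add_le hG2
    have h2 : infNorm G ^ 2 ≤ (B₁ + B₂) ^ 2 * η ^ 2 := by
      rw [← mul_pow]
      exact pow_le_pow_left₀ (infNorm_nonneg G) hGη 2
    linarith [sq_nonneg β]

theorem mainTheorem1 {m n : ℕ} (hn : 0 < n) (hmn : n ≤ m) :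
    -- the concrete bound on `ρ`
    (∀ (d : Fin m → ℝ) (Q : Matrix (Fin m) (Fin n) ℝ), (∀ i, 0 < d i) → Qᵀ * Q = 1 →
      rhoWeight (diagonal d) Q ≤ Real.sqrt (condTwo (diagonal d))) ∧
    -- the block formulas for the inverse of the preconditioner and for `M_l⁻¹ Ẽ`
    (∀ (d : Fin m → ℝ) (A Q : Matrix (Fin m) (Fin n) ℝ) (R : Matrix (Fin n) (Fin n) ℝ) (α : ℝ),
      (∀ i, 0 < d i) → Qᵀ * Q = 1 → IsUnit R → α ≠ 0 →
      ∀ (D : Matrix (Fin m) (Fin m) ℝ) (S : Matrix (Fin n) (Fin n) ℝ)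
        (E : Matrix (Fin m) (Fin n) ℝ),
        D = diagonal d → S = Qᵀ * D * Q → E = qrError A Q R →
        IsUnit S ∧ IsUnit (leftPrecond α D Q R) ∧
        (leftPrecond α D Q R)⁻¹ =
          fromBlocks (α⁻¹ • (D - D * Q * S⁻¹ * Qᵀ * D)) (D * Q * S⁻¹ * (R⁻¹)ᵀ)
            (R⁻¹ * S⁻¹ * Qᵀ * D) (-(α • (R⁻¹ * S⁻¹ * (R⁻¹)ᵀ))) ∧
        (leftPrecond α D Q R)⁻¹ * augError α D A Q R =
          fromBlocks (-(D * Q * S⁻¹ * (R⁻¹)ᵀ * Eᵀ))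
            (-(α⁻¹ • ((D - D * Q * S⁻¹ * Qᵀ * D) * E)))
            (α • (R⁻¹ * S⁻¹ * (R⁻¹)ᵀ * Eᵀ)) (-(R⁻¹ * S⁻¹ * Qᵀ * D * E))) ∧
    -- the parameters `ρ` and `θ` in the unweighted case
    (∀ Q : Matrix (Fin m) (Fin n) ℝ, Qᵀ * Q = 1 →
      rhoWeight (1 : Matrix (Fin m) (Fin m) ℝ) Q = 1) ∧
    thetaWeight (1 : Matrix (Fin m) (Fin m) ℝ) = 1 ∧
    -- the first-order bounds; `δ` and `C` depend on `m`, `n`, `c`, `K` only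
    (∀ c K : ℝ, 0 < c → 0 ≤ K → ∃ δ > (0 : ℝ), ∃ C > (0 : ℝ),
      (∀ (d : Fin m → ℝ) (A Q : Matrix (Fin m) (Fin n) ℝ) (R : Matrix (Fin n) (Fin n) ℝ)
        (α u : ℝ), (∀ i, 0 < d i) → A.rank = n → 0 < u → IsComputedQR c u A Q R →
        |(|α| * specNorm (pinv A)) - 1| ≤ K * u →
        ∀ (D : Matrix (Fin m) (Fin m) ℝ) (ρ θ : ℝ),
          D = diagonal d → ρ = rhoWeight D Q → θ = thetaWeight D →
          ρ * θ * condInfRect A * u ≤ δ →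
          α ≠ 0 ∧ IsUnit R ∧ IsUnit (leftPrecond α D Q R) ∧ IsUnit (augMatrix α D A) ∧
          infNorm ((leftPrecond α D Q R)⁻¹ * augError α D A Q R) ≤
            (Real.sqrt m + Real.sqrt n) * ρ * θ * specNorm (pinv A) * frobNorm (qrError A Q R)
              + C * (ρ * θ * condInfRect A * u) ^ 2 ∧
          infNorm ((leftPrecond α D Q R)⁻¹ * augError α D A Q R) ≤
            2 * m * Real.sqrt n * ρ * θ * gammaTilde c m n u * condInfRect A
              + C * (ρ * θ * condInfRect A * u) ^ 2 ∧
          condInf ((leftPrecond α D Q R)⁻¹ * augMatrix α D A) ≤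
            (1 + 2 * m * Real.sqrt n * ρ * θ * gammaTilde c m n u * condInfRect A) ^ 2
              + C * (ρ * θ * condInfRect A * u) ^ 2) ∧
      -- the unweighted case `D = I`
      (∀ (A Q : Matrix (Fin m) (Fin n) ℝ) (R : Matrix (Fin n) (Fin n) ℝ) (α u : ℝ),
        A.rank = n → 0 < u → IsComputedQR c u A Q R →
        |(|α| * specNorm (pinv A)) - 1| ≤ K * u → condInfRect A * u ≤ δ →
        condInf ((fromBlocks (α • 1) (Q * R) (Rᵀ * Qᵀ) 0)⁻¹ * fromBlocks (α • 1) A Aᵀ 0) ≤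
          (1 + 2 * m * Real.sqrt n * gammaTilde c m n u * condInfRect A) ^ 2
            + C * (condInfRect A * u) ^ 2)) := by
  refine ⟨fun d Q hd hQ => rhoWeight_le_sqrt_condTwo hd hQ, ?_, fun Q hQ => rhoWeight_one hn hQ,
    thetaWeight_one (hn.trans_le hmn), ?_⟩
  · intro d A Q R α hd hQ hR hα D S E hD hS hE
    exact preconditioner_formulas hd hQ hR hα hD hS hE
  · intro c K hc hK
    obtain ⟨δ, hδ, C, hC, h⟩ := first_order_bounds hn hmn hc hK
    refine ⟨δ, hδ, C, hC, h, ?_⟩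
    intro A Q R α u hA hu hQR hα hκ
    -- For `D = I` one has `ρ = θ = 1`, so `η` is `κ∞(A) u` and the same `δ` and `C` serve.
    have h1 := h (fun _ => 1) A Q R α u (fun _ => one_pos) hA hu hQR hα 1 1 1
      Matrix.diagonal_one.symm (rhoWeight_one hn hQR.orthonormal).symm
      (thetaWeight_one (hn.trans_le hmn)).symm (by simpa using hκ)
    simpa [leftPrecond, augMatrix] using h1.2.2.2.2.2.2
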